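/- Let $n\in\mathbb N$ and let $M$ be a metric space with a fixed base point $0\in M$ such that $d(x,y)\in\{0,1,\dots,n\}$ for all $x,y\in M$. Let $\widetilde M=\{(x,y)\in M\times M : x\neq y\}$. Let $\mathrm{Lip}_0(M)$ be the Banach space of Lipschitz functions $f\colon M\to\mathbb R$ with $f(0)=0$, normed by the best Lipschitz constant, and let $B_{\mathrm{Lip}_0(M)}$ be its closed unit ball. For $(x,y)\in\widetilde M$ let $m_{x,y}=\frac{\delta_x-\delta_y}{d(x,y)}$ be the associated molecule, so that $f(m_{x,y})=\frac{f(x)-f(y)}{d(x,y)}$ for $f\in \mathrm{Lip}_0(M)$. Let $\Phi\colon \mathrm{Lip}_0(M)\to\ell_\infty(\widetilde M)$, $(\Phi f)(x,y)=\frac{f(x)-f(y)}{d(x,y)}$, be de Leeuw's isometric embedding. Let $ba(\widetilde M)=\ell_\infty(\widetilde M)^*$ be the space of bounded finitely additive signed measures on the power set of $\widetilde M$ with the total variation norm $\|\mu\|=|\mu|(\widetilde M)$, and let $\Phi^*\mu\in \mathrm{Lip}_0(M)^*$ be the functional $(\Phi^*\mu)(f)=\int_{\widetilde M}\Phi f\,d\mu$.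 A set $B\subseteq\widetilde M$ is called cyclically monotonic if for every finite sequence $(x_1,y_1),\dots,(x_k,y_k)\in B$ one has $\sum_{i=1}^k d(x_i,y_{i+1})\ge\sum_{i=1}^k d(x_i,y_i)$, where $y_{k+1}=y_1$. Let $\mu\in ba(\widetilde M)$ be positive. Then the following conditions are equivalent: (i) $\|\Phi^*\mu\|=\|\mu\|$. (ii) For every $\gamma\in(0,1)$ there exist a set $B\subseteq\widetilde M$ and a function $f\in B_{\mathrm{Lip}_0(M)}$ such that $\mu(B)\ge\gamma\,\mu(\widetilde M)$ and $f(m_{x,y})=1$ for all $(x,y)\in B$. (iii) For every $\gamma\in(0,1)$ there exists a cyclically monotonic set $B\subseteq\widetilde M$ with $\mu(B)\ge\gamma\,\mu(\widetilde M)$. -/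

import Mathlib

open scoped ENNReal

noncomputable section

namespace LipDual

/-! ### Bounded finitely additive signed measures on a power set -/

/-- `BA X` is the set `ba(X)` of bounded, finitely additive signed measures on the power set
of `X`: real-valued additive contents defined on all subsets of `X`, with bounded range. -/
structure BA (X : Type*) extends
    MeasureTheory.AddContent ℝ (Set.univ : Set (Set X)) where
  bounded' : ∃ K : ℝ, ∀ A : Set X, |toFun A| ≤ K

namespace BA

variable {X : Type*}

instance : CoeFun (BA X) (fun _ => Set X → ℝ) := ⟨fun μ => μ.toFun⟩

/-- A signed measure is positive if all its values are nonnegative. -/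
def IsPositive (μ : BA X) : Prop := ∀ A : Set X, 0 ≤ μ A

/-- The norm of `ba(X)`: the total variation `|μ|(X)`, that is, the supremum of `∑ |μ(A_i)|` over
all finite families of pairwise disjoint subsets `A_i` of `X`. -/
instance : Norm (BA X) where
  norm μ := ⨆ P : {P : Finset (Set X) // (P : Set (Set X)).PairwiseDisjoint id},
    ∑ A ∈ P.1, |μ A|

theorem sum_eq (μ : BA X) {ι : Type*} (s : Finset ι) (f : ι → Set X)
    (h : (s : Set ι).PairwiseDisjoint f) : ∑ i ∈ s, μ (f i) = μ (⋃ i ∈ s, f i) :=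
  (MeasureTheory.addContent_biUnion (m := μ.toAddContent) (fun _ _ => Set.mem_univ _) h
    (Set.mem_univ _)).symm

theorem exists_bound (μ : BA X) (ι : Type*) : ∃ K : ℝ, 0 ≤ K ∧
    ∀ (s : Finset ι) (f : ι → Set X),
      (s : Set ι).PairwiseDisjoint f → ∑ i ∈ s, |μ (f i)| ≤ K := by
  obtain ⟨K, hK⟩ := μ.bounded'
  have hK0 : 0 ≤ K := (abs_nonneg _).trans (hK ∅)
  refine ⟨K + K, by positivity, fun s f h => ?_⟩
  classical
  rw [← Finset.sum_filter_add_sum_filter_not s (fun i => 0 ≤ μ (f i))]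
  refine add_le_add ?_ ?_
  · rw [Finset.sum_congr rfl fun i hi => abs_of_nonneg (Finset.mem_filter.1 hi).2,
      sum_eq μ _ f (h.subset fun i hi => (Finset.mem_filter.1 hi).1)]
    exact (le_abs_self _).trans (hK _)
  · rw [Finset.sum_congr rfl fun i hi => abs_of_neg (not_le.1 (Finset.mem_filter.1 hi).2),
      Finset.sum_neg_distrib, sum_eq μ _ f (h.subset fun i hi => (Finset.mem_filter.1 hi).1)]
    exact (neg_le_abs _).trans (hK _)

/-- The supremum defining the total variation norm is taken over a bounded set. -/
theorem bddAbove_variation (μ : BA X) :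
    BddAbove (Set.range fun P : {P : Finset (Set X) // (P : Set (Set X)).PairwiseDisjoint id} =>
      ∑ A ∈ P.1, |μ A|) := by
  obtain ⟨K, -, hK⟩ := μ.exists_bound (Set X)
  exact ⟨K, by rintro _ ⟨P, rfl⟩; exact hK P.1 id P.2⟩

/-! ### The integral of a bounded function -/

/-- The Banach space `ℓ_∞(X)` of bounded real functions with the supremum norm. -/
abbrev Linf (X : Type*) : Type _ := lp (fun _ : X => ℝ) ∞

/-- The indicator function of `A` as an element of `ℓ_∞(X)`. -/
def ind (A : Set X) : Linf X :=
  ⟨A.indicator 1, memℓp_infty ⟨1, by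
    rintro _ ⟨x, rfl⟩
    by_cases hx : x ∈ A <;> simp [hx]⟩⟩

@[simp] theorem ind_apply (A : Set X) (x : X) : ind A x = A.indicator (1 : X → ℝ) x := rfl

theorem linf_sum_apply {ι : Type*} (s : Finset ι) (g : ι → Linf X) (x : X) :
    (∑ i ∈ s, g i : Linf X) x = ∑ i ∈ s, g i x := by
  classical
  induction s using Finset.induction_on with
  | empty => simp
  | insert a t ha ih =>
    rw [Finset.sum_insert ha, Finset.sum_insert ha, lp.coeFn_add, Pi.add_apply, ih]

/-- The simple function `∑ c_A 1_A` attached to a finite formal combination of sets. -/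
def simpleFun (X : Type*) : (Set X →₀ ℝ) →ₗ[ℝ] Linf X :=
  Finsupp.linearCombination ℝ ind

/-- The elementary integral `∑ c_A μ(A)` of the simple function `∑ c_A 1_A`. -/
def simpleIntegral (μ : BA X) : (Set X →₀ ℝ) →ₗ[ℝ] ℝ :=
  Finsupp.linearCombination ℝ (fun A => μ A)

theorem simpleFun_apply (c : Set X →₀ ℝ) (x : X) :
    simpleFun X c x = ∑ A ∈ c.support, c A * A.indicator (1 : X → ℝ) x := by
  rw [simpleFun, Finsupp.linearCombination_apply, Finsupp.sum, linf_sum_apply]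
  rfl

theorem simpleIntegral_bound (μ : BA X) :
    ∃ C : ℝ, ∀ c, ‖simpleIntegral μ c‖ ≤ C * ‖simpleFun X c‖ := by
  classical
  obtain ⟨K, hK0, hK⟩ := μ.exists_bound (Finset (Set X))
  refine ⟨K, fun c => ?_⟩
  let atom : Finset (Set X) → Set X := fun T => {x | ∀ A ∈ c.support, x ∈ A ↔ A ∈ T}
  have hdisj : (c.support.powerset : Set (Finset (Set X))).PairwiseDisjoint atom := by
    intro T hT U hU hTU
    refine Set.disjoint_left.2 fun x hx hx' => hTU ?_
    have hT' := Finset.mem_powerset.1 hT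
    have hU' := Finset.mem_powerset.1 hU
    ext A
    exact ⟨fun h => (hx' A (hT' h)).1 ((hx A (hT' h)).2 h),
      fun h => (hx A (hU' h)).1 ((hx' A (hU' h)).2 h)⟩
  have hμ : ∀ A ∈ c.support, μ A = ∑ T ∈ c.support.powerset, if A ∈ T then μ (atom T) else 0 := by
    intro A hA
    rw [← Finset.sum_filter, sum_eq μ _ atom (hdisj.subset (by
      intro T hT; exact (Finset.mem_filter.1 hT).1))]
    congr 1
    ext x
    simp only [Set.mem_iUnion, Finset.mem_filter, Finset.mem_powerset, exists_prop]
    constructor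
    · intro hx
      refine ⟨c.support.filter (fun B => x ∈ B), ⟨Finset.filter_subset _ _, ?_⟩, fun B hB => ?_⟩
      · exact Finset.mem_filter.2 ⟨hA, hx⟩
      · simp only [Finset.mem_filter, hB, true_and]
    · rintro ⟨T, ⟨-, hAT⟩, hx⟩
      exact (hx A hA).2 hAT
  have hsum : simpleIntegral μ c =
      ∑ T ∈ c.support.powerset, (∑ A ∈ c.support, if A ∈ T then c A else 0) * μ (atom T) := by
    have : simpleIntegral μ c = ∑ A ∈ c.support, c A * μ A := by
      simp [simpleIntegral, Finsupp.linearCombination_apply, Finsupp.sum]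
    rw [this, Finset.sum_congr rfl fun A hA => by rw [hμ A hA, Finset.mul_sum], Finset.sum_comm]
    refine Finset.sum_congr rfl fun T _ => ?_
    rw [Finset.sum_mul]
    refine Finset.sum_congr rfl fun A _ => ?_
    split_ifs <;> simp
  rw [hsum]
  calc ‖∑ T ∈ c.support.powerset, (∑ A ∈ c.support, if A ∈ T then c A else 0) * μ (atom T)‖
      ≤ ∑ T ∈ c.support.powerset, ‖simpleFun X c‖ * |μ (atom T)| := by
        refine (norm_sum_le _ _).trans (Finset.sum_le_sum fun T _ => ?_)
        rw [norm_mul, Real.norm_eq_abs (μ (atom T))]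
        rcases (atom T).eq_empty_or_nonempty with h | ⟨x, hx⟩
        · have h0 : μ (∅ : Set X) = 0 := μ.empty'
          simp [h, h0]
        · refine mul_le_mul_of_nonneg_right ?_ (abs_nonneg _)
          have : (∑ A ∈ c.support, if A ∈ T then c A else 0) = simpleFun X c x := by
            rw [simpleFun_apply]
            refine Finset.sum_congr rfl fun A hA => ?_
            have := hx A hA
            by_cases h : A ∈ T
            · simp [h, this.2 h]
            · have hxA : x ∉ A := fun h' => h (this.1 h')
              simp [h, hxA]
          rw [this]
          exact lp.norm_apply_le_norm (by simp) _ x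
    _ ≤ K * ‖simpleFun X c‖ := by
        rw [← Finset.mul_sum, mul_comm]
        exact mul_le_mul_of_nonneg_right (hK _ _ hdisj) (norm_nonneg _)

theorem denseRange_simpleFun : DenseRange (simpleFun X) := by
  classical
  refine Metric.denseRange_iff.2 fun g ε hε => ?_
  obtain ⟨N, hN⟩ := exists_nat_gt (‖g‖ / (ε / 2))
  have hgN : ∀ x, |g x| ≤ N * (ε / 2) := fun x =>
    (lp.norm_apply_le_norm (by simp) g x).trans ((div_lt_iff₀ (by positivity)).1 hN).le
  let lev : ℤ → Set X := fun k => {x | ⌊g x / (ε / 2)⌋ = k}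
  let c : Set X →₀ ℝ := ∑ k ∈ Finset.Icc (-N : ℤ) N, Finsupp.single (lev k) (k * (ε / 2))
  refine ⟨c, ?_⟩
  have hc : ∀ x, simpleFun X c x = ⌊g x / (ε / 2)⌋ * (ε / 2) := by
    intro x
    have h1 : simpleFun X c x = ∑ k ∈ Finset.Icc (-N : ℤ) N,
        (k * (ε / 2) : ℝ) * (lev k).indicator (1 : X → ℝ) x := by
      rw [map_sum, linf_sum_apply]
      refine Finset.sum_congr rfl fun k _ => ?_
      rw [simpleFun, Finsupp.linearCombination_single]
      rfl
    have hb := abs_le.1 (hgN x)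
    have hmem : ⌊g x / (ε / 2)⌋ ∈ Finset.Icc (-N : ℤ) N := by
      rw [Finset.mem_Icc]
      constructor
      · rw [Int.le_floor, le_div_iff₀ (by positivity)]; push_cast; linarith
      · have : (⌊g x / (ε / 2)⌋ : ℝ) ≤ N :=
          (Int.floor_le _).trans ((div_le_iff₀ (by positivity)).2 hb.2)
        exact_mod_cast this
    rw [h1, Finset.sum_eq_single_of_mem _ hmem]
    · simp [lev]
    · intro k _ hk
      have : x ∉ lev k := fun h => hk h.symm
      simp [this]
  rw [dist_eq_norm]
  refine lt_of_le_of_lt (lp.norm_le_of_forall_le (C := ε / 2) (by positivity) fun x => ?_)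
    (half_lt_self hε)
  rw [lp.coeFn_sub, Pi.sub_apply, hc, Real.norm_eq_abs, abs_le]
  have h1 := Int.floor_le (g x / (ε / 2))
  have h2 := Int.lt_floor_add_one (g x / (ε / 2))
  rw [le_div_iff₀ (by positivity)] at h1
  rw [div_lt_iff₀ (by positivity)] at h2
  constructor <;> linarith

/-- The functional `g ↦ ∫ g dμ` on `ℓ_∞(X)` defined by `μ ∈ ba(X)`: the continuous extension
of the elementary integral `∑ c_A 1_A ↦ ∑ c_A μ(A)` from the dense space of simple functions. -/
def integral (μ : BA X) : StrongDual ℝ (Linf X) :=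
  (simpleIntegral μ).extendOfNorm (simpleFun X)

theorem integral_simpleFun (μ : BA X) (c : Set X →₀ ℝ) :
    μ.integral (simpleFun X c) = simpleIntegral μ c :=
  LinearMap.extendOfNorm_eq denseRange_simpleFun (simpleIntegral_bound μ) c

@[simp] theorem integral_ind (μ : BA X) (A : Set X) : μ.integral (ind A) = μ A := by
  simpa [simpleFun, simpleIntegral] using integral_simpleFun μ (Finsupp.single A 1)

end BA

/-! ### Lipschitz functions vanishing at the base point -/

/-- `M̃`, the set of pairs of distinct points of `M`. -/
abbrev OffDiag (M : Type*) : Type _ := {p : M × M // p.1 ≠ p.2}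

variable {M : Type*} [MetricSpace M]

/-- The Lipschitz functions `M → ℝ` vanishing at the base point `o`, as a space of functions. -/
def lipSubmodule (o : M) : Submodule ℝ (M → ℝ) where
  carrier := {f | f o = 0 ∧ ∃ K, LipschitzWith K f}
  zero_mem' := ⟨rfl, 0, LipschitzWith.const 0⟩
  add_mem' := by
    rintro f g ⟨hf, K, hK⟩ ⟨hg, L, hL⟩
    exact ⟨by simp [hf, hg], K + L, hK.add hL⟩
  smul_mem' := by
    rintro a f ⟨hf, K, hK⟩
    exact ⟨by simp [hf], ‖a‖₊ * K, (lipschitzWith_smul a).comp hK⟩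

/-- The space `Lip₀(M)` for the pointed metric space `(M, o)`. Its norm is introduced below. -/
def Lip0 (o : M) : Type _ := lipSubmodule o

namespace Lip0

variable {o : M}

instance : AddCommGroup (Lip0 o) := inferInstanceAs (AddCommGroup (lipSubmodule o))

instance : Module ℝ (Lip0 o) := inferInstanceAs (Module ℝ (lipSubmodule o))

instance : CoeFun (Lip0 o) (fun _ => M → ℝ) := ⟨fun f => f.1⟩

theorem ext {f g : Lip0 o} (h : ∀ x, f x = g x) : f = g := Subtype.ext (funext h)

@[simp] theorem base_eq (f : Lip0 o) : f o = 0 := f.2.1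

theorem exists_lipschitz (f : Lip0 o) : ∃ K, LipschitzWith K f := f.2.2

@[simp] theorem add_apply (f g : Lip0 o) (x : M) : (f + g) x = f x + g x := rfl

@[simp] theorem smul_apply (a : ℝ) (f : Lip0 o) (x : M) : (a • f) x = a * f x := rfl

theorem abs_slope_le {f : M → ℝ} {K : NNReal} (hK : LipschitzWith K f) (p : OffDiag M) :
    |(f p.1.1 - f p.1.2) / dist p.1.1 p.1.2| ≤ K := by
  rw [abs_div, abs_of_nonneg dist_nonneg, div_le_iff₀ (dist_pos.2 p.2), ← Real.dist_eq]
  exact hK.dist_le_mul _ _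

/-- De Leeuw's map, as a linear map: `f ↦ f̃`, `f̃(x, y) = (f(x) - f(y)) / d(x, y)`. -/
def deLeeuwLin (o : M) : Lip0 o →ₗ[ℝ] BA.Linf (OffDiag M) where
  toFun f := ⟨fun p => (f p.1.1 - f p.1.2) / dist p.1.1 p.1.2, memℓp_infty (by
    obtain ⟨K, hK⟩ := f.exists_lipschitz
    exact ⟨K, by rintro _ ⟨p, rfl⟩; exact abs_slope_le hK p⟩)⟩
  map_add' f g := by
    ext p
    simp only [lp.coeFn_add, Pi.add_apply, add_apply]
    ring
  map_smul' a f := by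
    ext p
    simp only [lp.coeFn_smul, Pi.smul_apply, smul_apply, smul_eq_mul, RingHom.id_apply]
    ring

theorem deLeeuwLin_apply (f : Lip0 o) (p : OffDiag M) :
    deLeeuwLin o f p = (f p.1.1 - f p.1.2) / dist p.1.1 p.1.2 := rfl

theorem deLeeuwLin_injective : Function.Injective (deLeeuwLin o) := by
  intro f g h
  refine ext fun x => ?_
  by_cases hx : x = o
  · rw [hx, base_eq, base_eq]
  · have := congrArg (fun u : BA.Linf (OffDiag M) => u ⟨(x, o), hx⟩) h
    simp only [deLeeuwLin_apply, base_eq, sub_zero] at this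
    exact (div_left_inj' (dist_pos.2 hx).ne').1 this

/-- `Lip₀(M)` with the norm `‖f‖ = sup {|f(x) - f(y)| / d(x, y) : x ≠ y}`, the best Lipschitz
constant of `f` (see `norm_eq_iSup` and `norm_le_iff`). -/
instance : NormedAddCommGroup (Lip0 o) :=
  NormedAddCommGroup.induced (Lip0 o) (BA.Linf (OffDiag M)) (deLeeuwLin o) deLeeuwLin_injective

instance : NormedSpace ℝ (Lip0 o) := NormedSpace.induced ℝ (Lip0 o) _ (deLeeuwLin o)

theorem norm_eq_iSup (f : Lip0 o) :
    ‖f‖ = ⨆ p : OffDiag M, |f p.1.1 - f p.1.2| / dist p.1.1 p.1.2 := by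
  change ‖deLeeuwLin o f‖ = _
  rw [lp.norm_eq_ciSup]
  congr 1
  ext p
  rw [deLeeuwLin_apply, Real.norm_eq_abs, abs_div, abs_of_nonneg dist_nonneg]

theorem norm_le_iff (f : Lip0 o) (K : NNReal) : ‖f‖ ≤ K ↔ LipschitzWith K f := by
  constructor
  · intro h
    refine LipschitzWith.of_dist_le_mul fun x y => ?_
    by_cases hxy : x = y
    · simp [hxy]
    · have h1 := (lp.norm_apply_le_norm (by simp) (deLeeuwLin o f) ⟨(x, y), hxy⟩).trans h
      rw [deLeeuwLin_apply, Real.norm_eq_abs, abs_div, abs_of_nonneg dist_nonneg,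
        div_le_iff₀ (dist_pos.2 hxy)] at h1
      exact h1
  · intro h
    exact lp.norm_le_of_forall_le K.2 fun p => abs_slope_le h p

/-- De Leeuw's map `Φ : Lip₀(M) → ℓ_∞(M̃)`, a linear isometry. -/
def deLeeuw (o : M) : Lip0 o →ₗᵢ[ℝ] BA.Linf (OffDiag M) :=
  ⟨deLeeuwLin o, fun _ => rfl⟩

/-- The adjoint `Φ* : ba(M̃) = ℓ_∞(M̃)* → Lip₀(M)*`, so that `(Φ* μ)(f) = ∫ f̃ dμ`. The codomain
carries the operator norm. -/
def deLeeuwAdjoint (o : M) (μ : BA (OffDiag M)) : StrongDual ℝ (Lip0 o) :=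
  μ.integral.comp (deLeeuw o).toContinuousLinearMap

/-- Evaluation `δ_x : f ↦ f(x)` as an element of `Lip₀(M)*`. -/
def eval (o x : M) : StrongDual ℝ (Lip0 o) :=
  LinearMap.mkContinuous
    { toFun := fun f => f x
      map_add' := fun _ _ => rfl
      map_smul' := fun _ _ => rfl } (dist x o) fun f => by
    have h := ((norm_le_iff f ‖f‖₊).1 le_rfl).dist_le_mul x o
    rw [base_eq, Real.dist_eq, sub_zero, coe_nnnorm, mul_comm] at h
    exact h

/-- The molecule `m_{x,y} = (δ_x - δ_y) / d(x, y)`, an element of the Lipschitz-free space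
(the closed linear span of the evaluations in `Lip₀(M)*`). A function `f ∈ Lip₀(M)` acts on it
by `f(m_{x,y}) = m_{x,y}(f)`. -/
def molecule (o : M) (p : OffDiag M) : StrongDual ℝ (Lip0 o) :=
  (dist p.1.1 p.1.2)⁻¹ • (eval o p.1.1 - eval o p.1.2)

theorem molecule_apply (p : OffDiag M) (f : Lip0 o) :
    molecule o p f = (f p.1.1 - f p.1.2) / dist p.1.1 p.1.2 := by
  rw [div_eq_inv_mul]; rfl

end Lip0

/-- `A ⊆ M̃` is cyclically monotonic if `∑ d(x_i, y_i) ≤ ∑ d(x_i, y_{i+1})` for each nonempty finite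
sequence of pairs `(x_i, y_i) ∈ A`, with cyclic indices (addition in `Fin (k + 1)` wraps around). -/
def CyclicallyMonotonic (A : Set (OffDiag M)) : Prop :=
  ∀ (k : ℕ) (p : Fin (k + 1) → OffDiag M), (∀ i, p i ∈ A) →
    ∑ i, dist (p i).1.1 (p i).1.2 ≤ ∑ i, dist (p i).1.1 (p (i + 1)).1.2

end LipDual

end

/-! The hard implication is (i) ⇒ (ii), where integrality of the distances is used. A function `f`
in the unit ball that almost attains `‖Φ* μ‖` has slope close to 1 outside a set of small measure,
by Chebyshev's inequality (`mul_apply_compl_slope_le`). As distances are at most `n`, this becomes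
`f x - f y > d(x, y) - 1 / N`. The rounded functions `⌊f + j / N⌋`, `j < N`, are still 1-Lipschitz,
and a given good pair loses its slope for at most one `j` (`floor_loss_unique`). The sets of losses
are therefore disjoint, and some `j` loses at most a fraction `1 / N` of the mass.

For (ii) ⇒ (i), integrating such an `f` gives at least `2 μ(B) - μ(M̃)`; let `γ → 1`.

(ii) ⇔ (iii) holds set by set: `B` is cyclically monotonic exactly when some 1-Lipschitz function
has slope 1 on it. One direction is a cyclic telescoping; the other is Rockafellar's construction of
a potential as an infimum of chain costs. -/

namespace LipDual

/-! ### Positive finitely additive measures. -/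

namespace BA

variable {X : Type*} {μ : BA X}

/-- The integral against a positive measure is a positive functional. -/
theorem IsPositive.integral_nonneg (hμ : μ.IsPositive) {g : Linf X} (hg : ∀ x, 0 ≤ g x) :
    0 ≤ μ.integral g := by
  refine le_of_forall_pos_le_add fun ε hε => ?_
  set η : ℝ := ε / (‖μ.integral‖ + 1)
  have hη : 0 < η := by positivity
  obtain ⟨N, hN⟩ := exists_nat_gt (‖g‖ / η)
  -- Layer-cake form of `g` rounded down to multiples of `η`: a nonnegative combination of
  -- indicators, within `η` of `g`.
  let s : Linf X := ∑ k ∈ Finset.range N, η • ind {x | k + 1 ≤ ⌊g x / η⌋₊}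
  have hs : 0 ≤ μ.integral s := by
    simp only [s, map_sum, map_smul, integral_ind, smul_eq_mul]
    exact Finset.sum_nonneg fun k _ => mul_nonneg hη.le (hμ _)
  have hval : ∀ x, s x = ⌊g x / η⌋₊ * η := by
    intro x
    have hx : ⌊g x / η⌋₊ ≤ N := by
      refine Nat.floor_le_of_le (le_trans ?_ hN.le)
      gcongr
      exact (le_abs_self _).trans (lp.norm_apply_le_norm (by simp) g x)
    have h1 : s x = ∑ k ∈ Finset.range N, η * (if k < ⌊g x / η⌋₊ then 1 else 0) := by
      simp only [s, linf_sum_apply]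
      refine Finset.sum_congr rfl fun k _ => ?_
      rw [lp.coeFn_smul, Pi.smul_apply, smul_eq_mul, ind_apply]
      simp [Set.indicator_apply]
    have h2 : (Finset.range N).filter (fun k => k < ⌊g x / η⌋₊) = Finset.range ⌊g x / η⌋₊ := by
      ext k
      simp only [Finset.mem_filter, Finset.mem_range]
      omega
    rw [h1, ← Finset.mul_sum, ← Finset.sum_filter, h2]
    simp [mul_comm]
  have hdist : ‖s - g‖ ≤ η := by
    refine lp.norm_le_of_forall_le hη.le fun x => ?_
    rw [lp.coeFn_sub, Pi.sub_apply, hval, Real.norm_eq_abs, abs_le]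
    have h1 := Nat.floor_le (div_nonneg (hg x) hη.le)
    have h2 := Nat.lt_floor_add_one (g x / η)
    rw [le_div_iff₀ hη] at h1
    rw [div_lt_iff₀ hη] at h2
    constructor <;> linarith
  have h3 : μ.integral s - μ.integral g ≤ ε := by
    rw [← map_sub]
    calc μ.integral (s - g) ≤ ‖μ.integral‖ * ‖s - g‖ :=
          (le_abs_self _).trans (μ.integral.le_opNorm _)
      _ ≤ (‖μ.integral‖ + 1) * η := by gcongr; linarith
      _ = ε := by simp only [η]; field_simp
  linarith

theorem IsPositive.integral_mono (hμ : μ.IsPositive) {g h : Linf X} (hgh : ∀ x, g x ≤ h x) :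
    μ.integral g ≤ μ.integral h := by
  rw [← sub_nonneg, ← map_sub]
  refine hμ.integral_nonneg fun x => ?_
  rw [lp.coeFn_sub, Pi.sub_apply]
  exact sub_nonneg.2 (hgh x)

theorem IsPositive.mono (hμ : μ.IsPositive) {A B : Set X} (h : A ⊆ B) : μ A ≤ μ B := by
  rw [← integral_ind, ← integral_ind]
  exact hμ.integral_mono fun x => Set.indicator_le_indicator_of_subset h (fun _ => zero_le_one) x

theorem apply_compl (μ : BA X) (A : Set X) : μ Aᶜ = μ Set.univ - μ A := by
  rw [← integral_ind, ← integral_ind, ← integral_ind, ← map_sub]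
  congr 1
  ext x
  rw [lp.coeFn_sub, Pi.sub_apply, ind_apply, ind_apply, ind_apply]
  by_cases hx : x ∈ A <;> simp [hx]

theorem IsPositive.union_le (hμ : μ.IsPositive) (A B : Set X) : μ (A ∪ B) ≤ μ A + μ B := by
  rw [← integral_ind, ← integral_ind, ← integral_ind, ← map_add]
  refine hμ.integral_mono fun x => ?_
  rw [lp.coeFn_add, Pi.add_apply, ind_apply, ind_apply, ind_apply]
  by_cases hA : x ∈ A <;> by_cases hB : x ∈ B <;> simp [hA, hB]

theorem IsPositive.norm_eq (hμ : μ.IsPositive) : ‖μ‖ = μ Set.univ := by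
  refine le_antisymm (Real.iSup_le (fun P => ?_) (hμ _)) ?_
  · rw [Finset.sum_congr rfl fun A _ => abs_of_nonneg (hμ A)]
    have := sum_eq μ P.1 id P.2
    simp only [id] at this
    rw [this]
    exact hμ.mono (Set.subset_univ _)
  · refine le_trans ?_ (le_ciSup μ.bddAbove_variation ⟨{Set.univ}, by simp⟩)
    simp [le_abs_self]

theorem IsPositive.abs_integral_le (hμ : μ.IsPositive) (g : Linf X) :
    |μ.integral g| ≤ μ Set.univ * ‖g‖ := by
  have hb : ∀ x, |g x| ≤ ‖g‖ := fun x => lp.norm_apply_le_norm (by simp) g x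
  have h1 : μ.integral g ≤ μ.integral (‖g‖ • ind Set.univ) := hμ.integral_mono fun x => by
    rw [lp.coeFn_smul, Pi.smul_apply, ind_apply]
    simpa using (abs_le.1 (hb x)).2
  have h2 : μ.integral (-(‖g‖ • ind Set.univ)) ≤ μ.integral g := hμ.integral_mono fun x => by
    rw [lp.coeFn_neg, Pi.neg_apply, lp.coeFn_smul, Pi.smul_apply, ind_apply]
    simpa using (abs_le.1 (hb x)).1
  simp only [map_neg, map_smul, integral_ind, smul_eq_mul] at h1 h2
  rw [abs_le]
  constructor <;> linarith

/-- Among finitely many pairwise disjoint sets, one has at most the average measure. -/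
theorem IsPositive.exists_mul_le (hμ : μ.IsPositive) {N : ℕ} (hN : 0 < N) (E : ℕ → Set X)
    (hE : ((Finset.range N : Finset ℕ) : Set ℕ).PairwiseDisjoint E) :
    ∃ j, N * μ (E j) ≤ μ Set.univ := by
  by_contra! h
  have h1 : ∑ j ∈ Finset.range N, μ (E j) ≤ μ Set.univ := by
    rw [sum_eq μ _ E hE]
    exact hμ.mono (Set.subset_univ _)
  have h2 : ∑ _j ∈ Finset.range N, μ Set.univ < ∑ j ∈ Finset.range N, N * μ (E j) :=
    Finset.sum_lt_sum_of_nonempty (Finset.nonempty_range_iff.2 hN.ne') fun j _ => h j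
  rw [← Finset.mul_sum, Finset.sum_const, Finset.card_range, nsmul_eq_mul] at h2
  exact absurd (lt_of_mul_lt_mul_left h2 (Nat.cast_nonneg N)) (not_lt.2 h1)

end BA

variable {M : Type*} [MetricSpace M] {o : M}

/-! ### Norm estimates for `Φ* μ`. -/

namespace Lip0

theorem deLeeuw_apply (f : Lip0 o) (p : OffDiag M) :
    deLeeuw o f p = (f p.1.1 - f p.1.2) / dist p.1.1 p.1.2 := rfl

theorem deLeeuwAdjoint_apply (μ : BA (OffDiag M)) (f : Lip0 o) :
    deLeeuwAdjoint o μ f = μ.integral (deLeeuw o f) := rfl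

theorem sub_le_dist {f : Lip0 o} (hf : ‖f‖ ≤ 1) (x y : M) : f x - f y ≤ dist x y := by
  have h := ((norm_le_iff f 1).1 hf).dist_le_mul x y
  rw [NNReal.coe_one, one_mul, Real.dist_eq] at h
  exact (le_abs_self _).trans h

/-- A function with `f x - f y ≤ d(x, y)`, shifted to vanish at the base point. -/
def ofSubLeDist (o : M) (f : M → ℝ) (hf : ∀ x y, f x - f y ≤ dist x y) : Lip0 o :=
  ⟨fun x => f x - f o, sub_self _, 1, LipschitzWith.of_le_add fun x y => by
    linarith [hf x y]⟩

theorem ofSubLeDist_apply (f : M → ℝ) (hf : ∀ x y, f x - f y ≤ dist x y) (x : M) :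
    ofSubLeDist o f hf x = f x - f o := rfl

theorem norm_ofSubLeDist_le (f : M → ℝ) (hf : ∀ x y, f x - f y ≤ dist x y) :
    ‖ofSubLeDist o f hf‖ ≤ 1 := by
  refine (norm_le_iff _ 1).2 (LipschitzWith.of_le_add fun x y => ?_)
  rw [ofSubLeDist_apply, ofSubLeDist_apply]
  linarith [hf x y]

theorem molecule_eq_one_iff (p : OffDiag M) (f : Lip0 o) :
    molecule o p f = 1 ↔ f p.1.1 - f p.1.2 = dist p.1.1 p.1.2 := by
  rw [molecule_apply, div_eq_one_iff_eq (dist_pos.2 p.2).ne']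

theorem norm_deLeeuwAdjoint_le {μ : BA (OffDiag M)} (hμ : μ.IsPositive) :
    ‖deLeeuwAdjoint o μ‖ ≤ μ Set.univ := by
  refine ContinuousLinearMap.opNorm_le_bound _ (hμ _) fun f => ?_
  rw [deLeeuwAdjoint_apply, Real.norm_eq_abs, ← (deLeeuw o).norm_map f]
  exact hμ.abs_integral_le _

/-- A function norming the molecules of `B` gives a lower bound for `‖Φ* μ‖`. -/
theorem le_norm_deLeeuwAdjoint {μ : BA (OffDiag M)} (hμ : μ.IsPositive) {f : Lip0 o}
    (hf : ‖f‖ ≤ 1) {B : Set (OffDiag M)} (hB : ∀ p ∈ B, molecule o p f = 1) :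
    2 * μ B - μ Set.univ ≤ ‖deLeeuwAdjoint o μ‖ := by
  -- The slope is 1 on `B` and at least -1 elsewhere, so `2 · 1_B - 1` minorizes it.
  have h1 : μ.integral ((2 : ℝ) • BA.ind B - BA.ind Set.univ) ≤ μ.integral (deLeeuw o f) := by
    refine hμ.integral_mono fun p => ?_
    rw [lp.coeFn_sub, Pi.sub_apply, lp.coeFn_smul, Pi.smul_apply, BA.ind_apply, BA.ind_apply]
    by_cases hp : p ∈ B
    · have := hB p hp
      rw [molecule_apply] at this
      rw [deLeeuw_apply, this]
      norm_num [hp]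
    · have := (abs_le.1 (abs_slope_le ((norm_le_iff f 1).1 hf) p)).1
      rw [deLeeuw_apply]
      simpa [hp] using this
  simp only [map_sub, map_smul, BA.integral_ind, smul_eq_mul] at h1
  refine h1.trans ((le_abs_self _).trans ?_)
  refine ((deLeeuwAdjoint o μ).le_opNorm f).trans ?_
  exact mul_le_of_le_one_right (norm_nonneg _) hf

theorem exists_lt_integral {μ : BA (OffDiag M)} {r : ℝ} (hr : r < ‖deLeeuwAdjoint o μ‖) :
    ∃ f : Lip0 o, ‖f‖ ≤ 1 ∧ r < μ.integral (deLeeuw o f) := by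
  obtain ⟨f, hf, hrf⟩ := ContinuousLinearMap.exists_lt_apply_of_lt_opNorm _ hr
  rw [Real.norm_eq_abs, lt_abs] at hrf
  rcases hrf with h | h
  · exact ⟨f, hf.le, h⟩
  · refine ⟨-f, by rw [norm_neg]; exact hf.le, ?_⟩
    rw [map_neg, map_neg]
    exact h

/-- Chebyshev's inequality for the set where the slope of `f` is close to one. -/
theorem mul_apply_compl_slope_le {μ : BA (OffDiag M)} (hμ : μ.IsPositive) {f : Lip0 o}
    (hf : ‖f‖ ≤ 1) (δ : ℝ) :
    δ * μ {p | 1 - δ < deLeeuw o f p}ᶜ ≤ μ Set.univ - μ.integral (deLeeuw o f) := by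
  have h1 : μ.integral (deLeeuw o f) ≤
      μ.integral (BA.ind Set.univ - δ • BA.ind {p | 1 - δ < deLeeuw o f p}ᶜ) := by
    refine hμ.integral_mono fun p => ?_
    rw [lp.coeFn_sub, Pi.sub_apply, lp.coeFn_smul, Pi.smul_apply, BA.ind_apply, BA.ind_apply]
    by_cases hp : 1 - δ < deLeeuw o f p
    · have := (abs_le.1 (abs_slope_le ((norm_le_iff f 1).1 hf) p)).2
      rw [← deLeeuw_apply] at this
      simpa [hp] using this
    · have hmem : p ∈ {p | 1 - δ < deLeeuw o f p}ᶜ := hp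
      rw [Set.indicator_of_mem hmem, Set.indicator_of_mem (Set.mem_univ p)]
      simpa using hp
  simp only [map_sub, map_smul, BA.integral_ind, smul_eq_mul] at h1
  linarith

/-! ### Rounding to integer-valued functions. -/

section Rounding

variable {f : Lip0 o}

/-- An integer distance can be pulled out of the floor, so rounding preserves the 1-Lipschitz bound.
-/
theorem floor_sub_floor_le (hM : ∀ x y : M, ∃ k : ℕ, dist x y = k) (hf : ‖f‖ ≤ 1) (t : ℝ)
    (x y : M) : (⌊f x + t⌋ : ℝ) - ⌊f y + t⌋ ≤ dist x y := by
  obtain ⟨k, hk⟩ := hM x y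
  have h := sub_le_dist hf x y
  rw [hk] at h ⊢
  have h1 : ⌊f x + t⌋ ≤ ⌊f y + t + k⌋ := Int.floor_mono (by linarith)
  rw [Int.floor_add_natCast] at h1
  have h2 : (⌊f x + t⌋ : ℝ) ≤ ⌊f y + t⌋ + k := by exact_mod_cast h1
  linarith

/-- If the slope of `f` is almost one at a pair of points, then at most one of the shifts `j / N`
makes the floor of `f + j / N` lose slope at this pair. -/
theorem floor_loss_unique (hM : ∀ x y : M, ∃ k : ℕ, dist x y = k) {N : ℕ}
    {x y : M} (hxy : dist x y - 1 / N < f x - f y) {i j : ℕ} (hi : i < N) (hj : j < N)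
    (hfi : (⌊f x + i / N⌋ : ℝ) - ⌊f y + i / N⌋ < dist x y)
    (hfj : (⌊f x + j / N⌋ : ℝ) - ⌊f y + j / N⌋ < dist x y) : i = j := by
  obtain ⟨k, hk⟩ := hM x y
  rw [hk] at hxy hfi hfj
  have hN : (0 : ℝ) < N := by exact_mod_cast (Nat.zero_le i).trans_lt hi
  -- A loss at shift `l` puts the integer `N z - l` in the open interval `(N f x, N f x + 1)`. This
  -- contains at most one integer, so two losing shifts agree modulo `N`.
  have key : ∀ l : ℕ, (⌊f x + l / N⌋ : ℝ) - ⌊f y + l / N⌋ < k →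
      ∃ z : ℤ, N * f x < N * z - l ∧ N * z - l < N * f x + 1 := by
    intro l hl
    have h1 : ⌊f x + l / N⌋ < ⌊f y + l / N⌋ + k := by
      have : (⌊f x + l / N⌋ : ℝ) < ⌊f y + l / N⌋ + k := by linarith
      exact_mod_cast this
    have h2 := Int.floor_lt.1 h1
    have h3 := Int.floor_le (f y + l / N)
    refine ⟨⌊f y + l / N⌋ + k, ?_, ?_⟩
    · have := mul_lt_mul_of_pos_left h2 hN
      rw [mul_add, mul_div_cancel₀ _ hN.ne'] at this
      linarith
    · have h4 : ((⌊f y + l / N⌋ + k : ℤ) : ℝ) < f x + l / N + 1 / N := by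
        push_cast
        linarith
      have := mul_lt_mul_of_pos_left h4 hN
      rw [mul_add, mul_add, mul_div_cancel₀ _ hN.ne', mul_div_cancel₀ _ hN.ne'] at this
      linarith
  obtain ⟨z, hz1, hz2⟩ := key i hfi
  obtain ⟨w, hw1, hw2⟩ := key j hfj
  have h1 : (N * z - i : ℤ) < N * w - j + 1 := by
    have : (N * z - i : ℝ) < N * w - j + 1 := by linarith
    exact_mod_cast this
  have h2 : (N * w - j : ℤ) < N * z - i + 1 := by
    have : (N * w - j : ℝ) < N * z - i + 1 := by linarith
    exact_mod_cast this
  have h3 : (N * z - i : ℤ) = N * w - j := by omega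
  have h4 : (i : ℤ) ≡ j [ZMOD N] := by
    refine Int.modEq_iff_dvd.2 ⟨w - z, ?_⟩
    linarith
  exact Nat.ModEq.eq_of_lt_of_lt ((Int.natCast_modEq_iff).1 h4) hi hj

end Rounding

/-- If all distances are natural numbers at most `n`, then a function in the unit ball which
almost norms `Φ* μ` can be rounded to one which norms most of the molecules. -/
theorem exists_molecule_eq_one (n : ℕ) (hM : ∀ x y : M, ∃ k : ℕ, k ≤ n ∧ dist x y = k)
    {μ : BA (OffDiag M)} (hμ : μ.IsPositive) (h : ‖deLeeuwAdjoint o μ‖ = μ Set.univ)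
    {γ : ℝ} (hγ : γ < 1) :
    ∃ (B : Set (OffDiag M)) (f : Lip0 o), ‖f‖ ≤ 1 ∧
      γ * μ Set.univ ≤ μ B ∧ ∀ p ∈ B, molecule o p f = 1 := by
  rcases (hμ Set.univ).eq_or_lt with hm | hm
  · refine ⟨∅, 0, by simp, ?_, by simp⟩
    rw [← hm, mul_zero]
    exact hμ _
  have hM' : ∀ x y : M, ∃ k : ℕ, dist x y = k := fun x y => (hM x y).imp fun _ => And.right
  -- Two losses of `μ(M̃) / N` each, from Chebyshev and from rounding, must fit into `(1 - γ)
  -- μ(M̃)`.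
  obtain ⟨N, hN⟩ := exists_nat_gt (2 / (1 - γ))
  have hN0 : (0 : ℝ) < N := (div_pos two_pos (sub_pos.2 hγ)).trans hN
  -- Turns a slope defect `δ` into a defect of at most `1 / N` over distances up to `n`; `n + 1`
  -- covers `n = 0`.
  set δ : ℝ := 1 / (N * (n + 1))
  have hδ : 0 < δ := by positivity
  have hr : μ Set.univ - δ / N * μ Set.univ < ‖deLeeuwAdjoint o μ‖ := by
    rw [h]
    have : 0 < δ / N * μ Set.univ := by positivity
    linarith
  obtain ⟨f, hf, hrf⟩ := exists_lt_integral hr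
  set B : Set (OffDiag M) := {p | 1 - δ < deLeeuw o f p}
  have hBc : N * μ Bᶜ ≤ μ Set.univ := by
    have h1 : δ * μ Bᶜ ≤ δ / N * μ Set.univ :=
      (mul_apply_compl_slope_le hμ hf δ).trans (by linarith)
    have h2 : δ / N * (N * μ Bᶜ) ≤ δ / N * μ Set.univ := by
      refine le_trans (le_of_eq ?_) h1
      field_simp
    exact le_of_mul_le_mul_left h2 (by positivity)
  have hslope : ∀ p ∈ B, dist p.1.1 p.1.2 - 1 / N < f p.1.1 - f p.1.2 := by
    intro p hp
    have hd := dist_pos.2 p.2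
    have h1 : 1 - δ < (f p.1.1 - f p.1.2) / dist p.1.1 p.1.2 := hp
    rw [lt_div_iff₀ hd] at h1
    have h2 : δ * dist p.1.1 p.1.2 ≤ 1 / N := by
      obtain ⟨k, hk, hdk⟩ := hM p.1.1 p.1.2
      have hkn : (k : ℝ) ≤ n := by exact_mod_cast hk
      rw [hdk]
      calc δ * k ≤ δ * (n + 1) := by gcongr; linarith
        _ = 1 / N := by simp only [δ]; field_simp
    linarith
  let g : ℕ → Lip0 o := fun j =>
    ofSubLeDist o (fun x => (⌊f x + j / N⌋ : ℝ)) (floor_sub_floor_le hM' hf _)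
  have hg : ∀ j p, molecule o p (g j) = 1 ↔
      (⌊f p.1.1 + j / N⌋ : ℝ) - ⌊f p.1.2 + j / N⌋ = dist p.1.1 p.1.2 := by
    intro j p
    rw [molecule_eq_one_iff, ofSubLeDist_apply, ofSubLeDist_apply, sub_sub_sub_cancel_right]
  let G : ℕ → Set (OffDiag M) := fun j => {p | molecule o p (g j) = 1}
  have hlt : ∀ j, ∀ p ∉ G j,
      (⌊f p.1.1 + j / N⌋ : ℝ) - ⌊f p.1.2 + j / N⌋ < dist p.1.1 p.1.2 := fun j p hp =>
    lt_of_le_of_ne (floor_sub_floor_le hM' hf _ _ _) fun h' => hp ((hg j p).2 h')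
  obtain ⟨j, hj⟩ := hμ.exists_mul_le (Nat.cast_pos.1 hN0) (fun j => B \ G j) (by
    intro i hi j hj hij
    refine Set.disjoint_left.2 fun p hpi hpj => hij ?_
    exact floor_loss_unique hM' (hslope p hpi.1) (Finset.mem_range.1 hi) (Finset.mem_range.1 hj)
      (hlt i p hpi.2) (hlt j p hpj.2))
  refine ⟨G j, g j, norm_ofSubLeDist_le _ _, ?_, fun p hp => hp⟩
  have hc : μ (G j)ᶜ ≤ μ Bᶜ + μ (B \ G j) := by
    refine (hμ.mono fun p hp => ?_).trans (hμ.union_le _ _)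
    by_cases hpB : p ∈ B
    · exact Or.inr ⟨hpB, hp⟩
    · exact Or.inl hpB
  rw [μ.apply_compl] at hc
  have h1 : N * (μ Set.univ - μ (G j)) ≤ N * ((1 - γ) * μ Set.univ) := by
    have h2 : 2 * μ Set.univ ≤ N * (1 - γ) * μ Set.univ := by
      gcongr
      exact ((div_lt_iff₀ (sub_pos.2 hγ)).1 hN).le
    have h3 := mul_le_mul_of_nonneg_left hc hN0.le
    linarith
  linarith [le_of_mul_le_mul_left h1 hN0]

end Lip0

/-! ### Cyclic monotonicity and potentials. -/

/-- The cost of the path from `o` to `z` which passes through the pairs of `l`, last pair first,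
where passing from `x` to `y` within a pair has cost `-d(x, y)`. -/
def chainCost (o : M) : List (OffDiag M) → M → ℝ
  | [], z => dist o z
  | p :: l, z => chainCost o l p.1.1 - dist p.1.1 p.1.2 + dist p.1.2 z

/-- Only the last leg depends on the endpoint. This makes the infimum of the costs 1-Lipschitz. -/
theorem chainCost_le_add_dist (l : List (OffDiag M)) (z w : M) :
    chainCost o l z ≤ chainCost o l w + dist z w := by
  cases l with
  | nil => simpa only [chainCost, dist_comm w z] using dist_triangle o w z
  | cons p l =>
    have := dist_triangle p.1.2 w z
    rw [dist_comm w z] at this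
    simp only [chainCost]
    linarith

/-- The legs are the terms of the cyclic sum except the wrap-around one, which is replaced by legs
to `o` and `z`. -/
theorem chainCost_ofFn (k : ℕ) (p : Fin (k + 1) → OffDiag M) (z : M) :
    chainCost o (List.ofFn p) z = dist (p 0).1.2 z +
      ∑ i : Fin k, dist (p i.castSucc).1.1 (p i.succ).1.2 + dist o (p (Fin.last k)).1.1 -
      ∑ i, dist (p i).1.1 (p i).1.2 := by
  induction k generalizing z with
  | zero =>
    simp [chainCost]
    ring
  | succ k ih =>
    have hs := Fin.sum_univ_succ fun i : Fin (k + 1) => dist (p i.castSucc).1.1 (p i.succ).1.2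
    simp only [Fin.castSucc_zero, Fin.castSucc_succ] at hs
    rw [List.ofFn_succ, chainCost, ih, Fin.sum_univ_succ (fun i : Fin (k + 1 + 1) =>
      dist (p i).1.1 (p i).1.2), hs, Fin.succ_last, dist_comm (p (Fin.succ 0)).1.2]
    simp only [Fin.succ_castSucc]
    ring

/-- Closing the path by a leg from `z` to `o` bounds the missing wrap-around term, by the triangle
inequality. The bound keeps the infimum of the costs finite. -/
theorem CyclicallyMonotonic.neg_dist_le_chainCost {B : Set (OffDiag M)}
    (hB : CyclicallyMonotonic B) {l : List (OffDiag M)} (hl : ∀ p ∈ l, p ∈ B) (z : M) :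
    -dist o z ≤ chainCost o l z := by
  rcases l with _ | ⟨q, l⟩
  · simp only [chainCost]
    linarith [dist_nonneg (x := o) (y := z)]
  have hofFn : List.ofFn (q :: l).get = q :: l := List.ofFn_get _
  have h := hB l.length (q :: l).get fun i => hl _ (List.get_mem _ _)
  have hc := chainCost_ofFn (o := o) l.length (q :: l).get z
  rw [hofFn] at hc
  rw [Fin.sum_univ_castSucc (n := l.length)
    (f := fun i => dist ((q :: l).get i).1.1 ((q :: l).get (i + 1)).1.2)] at h
  simp only [Fin.coeSucc_eq_succ, Fin.last_add_one] at h
  have h1 := dist_triangle4 ((q :: l).get (Fin.last l.length)).1.1 o z ((q :: l).get 0).1.2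
  rw [dist_comm _ o, dist_comm z] at h1
  rw [hc]
  linarith

/-- A cyclically monotonic set is contained in the contact set of a `1`-Lipschitz function. -/
theorem CyclicallyMonotonic.exists_molecule_eq_one (o : M) {B : Set (OffDiag M)}
    (hB : CyclicallyMonotonic B) :
    ∃ f : Lip0 o, ‖f‖ ≤ 1 ∧ ∀ p ∈ B, Lip0.molecule o p f = 1 := by
  let F : M → ℝ := fun z => ⨅ l : {l : List (OffDiag M) // ∀ p ∈ l, p ∈ B}, chainCost o l.1 z
  have : Nonempty {l : List (OffDiag M) // ∀ p ∈ l, p ∈ B} := ⟨⟨[], by simp⟩⟩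
  have hbdd : ∀ z, BddBelow (Set.range fun l : {l : List (OffDiag M) // ∀ p ∈ l, p ∈ B} =>
      chainCost o l.1 z) := fun z =>
    ⟨-dist o z, by rintro _ ⟨l, rfl⟩; exact hB.neg_dist_le_chainCost l.2 z⟩
  have hF : ∀ x y, F x - F y ≤ dist x y := by
    intro x y
    have : F x - dist x y ≤ F y := le_ciInf fun l => by
      linarith [ciInf_le (hbdd x) l, chainCost_le_add_dist (o := o) l.1 x y]
    linarith
  refine ⟨Lip0.ofSubLeDist o F hF, Lip0.norm_ofSubLeDist_le F hF, fun p hp => ?_⟩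
  rw [Lip0.molecule_eq_one_iff, Lip0.ofSubLeDist_apply, Lip0.ofSubLeDist_apply,
    sub_sub_sub_cancel_right]
  refine le_antisymm (hF _ _) ?_
  -- Extending a chain by `p` and stopping at its second point lowers the cost by exactly `d(x, y)`.
  have : F p.1.2 + dist p.1.1 p.1.2 ≤ F p.1.1 := le_ciInf fun l => by
    have h := ciInf_le (hbdd p.1.2) ⟨p :: l.1, by
      intro q hq
      rcases List.mem_cons.1 hq with rfl | hq
      · exact hp
      · exact l.2 q hq⟩
    simp only [chainCost, dist_self] at h
    linarith
  linarith

/-- The sum of the `f(y_i)` is unchanged by the cyclic shift, so the distances within pairs sum to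
the increments `f(x_i) - f(y_{i+1})`. -/
theorem cyclicallyMonotonic_of_molecule_eq_one {f : Lip0 o} (hf : ‖f‖ ≤ 1)
    {B : Set (OffDiag M)} (hB : ∀ p ∈ B, Lip0.molecule o p f = 1) : CyclicallyMonotonic B := by
  intro k p hp
  have h1 : ∑ i, f (p (i + 1)).1.2 = ∑ i, f (p i).1.2 :=
    Equiv.sum_comp (Equiv.addRight (1 : Fin (k + 1))) fun i => f (p i).1.2
  calc ∑ i, dist (p i).1.1 (p i).1.2 = ∑ i, (f (p i).1.1 - f (p i).1.2) :=
        Finset.sum_congr rfl fun i _ => ((Lip0.molecule_eq_one_iff _ _).1 (hB _ (hp i))).symm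
    _ = ∑ i, (f (p i).1.1 - f (p (i + 1)).1.2) := by
        rw [Finset.sum_sub_distrib, Finset.sum_sub_distrib, h1]
    _ ≤ ∑ i, dist (p i).1.1 (p (i + 1)).1.2 := Finset.sum_le_sum fun i _ => Lip0.sub_le_dist hf _ _

end LipDual

theorem proposition2p8 {M : Type*} [MetricSpace M] (o : M) (n : ℕ)
    (hM : ∀ x y : M, ∃ k : ℕ, k ≤ n ∧ dist x y = k)
    (μ : LipDual.BA (LipDual.OffDiag M)) (hμ : μ.IsPositive) :
    List.TFAE [
      ‖LipDual.Lip0.deLeeuwAdjoint o μ‖ = ‖μ‖,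
      ∀ γ : ℝ, 0 < γ → γ < 1 →
        ∃ (B : Set (LipDual.OffDiag M)) (f : LipDual.Lip0 o), ‖f‖ ≤ 1 ∧
          γ * μ Set.univ ≤ μ B ∧ ∀ p ∈ B, LipDual.Lip0.molecule o p f = 1,
      ∀ γ : ℝ, 0 < γ → γ < 1 →
        ∃ B : Set (LipDual.OffDiag M), LipDual.CyclicallyMonotonic B ∧
          γ * μ Set.univ ≤ μ B] := by
  rw [hμ.norm_eq]
  tfae_have 1 → 2 := fun h γ _ hγ => LipDual.Lip0.exists_molecule_eq_one n hM hμ h hγ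
  tfae_have 2 → 1 := by
    intro h
    refine le_antisymm (LipDual.Lip0.norm_deLeeuwAdjoint_le hμ) ?_
    -- The lower bound `(2γ - 1) μ(M̃)` tends to `μ(M̃)` as `γ` increases to 1.
    have hlim : Filter.Tendsto (fun γ : ℝ => 2 * (γ * μ Set.univ) - μ Set.univ)
        (nhdsWithin 1 (Set.Iio 1)) (nhds (2 * (1 * μ Set.univ) - μ Set.univ)) :=
      Filter.Tendsto.mono_left (Continuous.tendsto (by fun_prop) 1) nhdsWithin_le_nhds
    have hle := le_of_tendsto hlim (b := ‖LipDual.Lip0.deLeeuwAdjoint o μ‖) (by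
      filter_upwards [Ioo_mem_nhdsLT (zero_lt_one (α := ℝ))] with γ hγ
      obtain ⟨B, f, hf, hγB, hB⟩ := h γ hγ.1 hγ.2
      linarith [LipDual.Lip0.le_norm_deLeeuwAdjoint hμ hf hB])
    linarith
  tfae_have 2 → 3 := by
    intro h γ h0 h1
    obtain ⟨B, f, hf, hγB, hB⟩ := h γ h0 h1
    exact ⟨B, LipDual.cyclicallyMonotonic_of_molecule_eq_one hf hB, hγB⟩
  tfae_have 3 → 2 := by
    intro h γ h0 h1
    obtain ⟨B, hB, hγB⟩ := h γ h0 h1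
    obtain ⟨f, hf, hfB⟩ := hB.exists_molecule_eq_one o
    exact ⟨B, f, hf, hγB, hfB⟩
  tfae_finish
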